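/- A Coxeter system $(G,S)$ is a group $G$ with a finite generating set $S$ such that $G$ has the presentation $\langle S \mid (st)^{m_{s,t}}=1,\ s,t\in S\rangle$, where $m_{s,s}=1$, $m_{s,t}=m_{t,s}\in\{0,2,3,4,\dots\}$ for $s\neq t$, and $m_{s,t}=0$ means that there is no relation between $s$ and $t$. It is even if all $m_{s,t}$ with $s\ne t$ are even. Its graph $\Gamma$ has vertex set $S$, with distinct $s,t$ joined by an edge, labelled $m_{s,t}$, exactly when $m_{s,t}\neq 0$. The star $\operatorname{Star}(v)$ of a vertex $v$ is the labelled subgraph spanned by $v$ and its neighbours; isomorphisms of labelled graphs are graph isomorphisms that preserve the edge labels (vertices may be permuted). $\Gamma$ is triangle-free if no three vertices span a complete graph, and star-regular if the stars of any two vertices are isomorphic as labelled graphs. The geodesic growth function of $(G,S)$ is $\gamma_{(G,S)}\colon\mathbb N\to\mathbb N$, where $\gamma_{(G,S)}(r)$ is the number of words of length $r$ over $S$ that represent an element of $G$ of word length $r$ with respect to $S$. Theorem. Let $(G,S)$ be an even Coxeter system, with $S$ finite and non-empty, whose graph is triangle-free and star-regular. Then the geodesic growth of $(G,S)$ depends only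 on $|S|$ and the isomorphism class of the star of a vertex: there is a function $F$, assigning to each natural number and each isomorphism class of labelled graphs a function $\mathbb N\to\mathbb N$, such that $\gamma_{(G,S)}=F(|S|,[\operatorname{Star}(v)])$ for all such $(G,S)$ and all $v\in S$. In particular, if $(G_1,S_1)$ and $(G_2,S_2)$ are even Coxeter systems, with $S_1$ and $S_2$ finite, whose graphs are triangle-free and star-regular, if $|S_1|=|S_2|$, and if $\operatorname{Star}(v)\cong\operatorname{Star}(u)$ as labelled graphs for some $v\in S_1$ and $u\in S_2$, then $\gamma_{(G_1,S_1)}=\gamma_{(G_2,S_2)}$. -/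

import Mathlib

universe u v u₁ v₁ u₂ v₂


/-- A simplicial graph on the vertex set `V` whose edges are labelled by natural numbers.
The value `label u v` is only meaningful when `u` and `v` are adjacent. -/
structure LabelledGraph (V : Type*) where
  /-- the underlying simplicial graph -/
  graph : SimpleGraph V
  /-- the label of the edge joining two adjacent vertices -/
  label : V → V → ℕ
  label_symm : ∀ u v : V, graph.Adj u v → label u v = label v u

namespace LabelledGraph

/-- An isomorphism of labelled graphs: a graph isomorphism preserving the labels of the edges. -/
structure Iso {V W : Type*} (Γ : LabelledGraph V) (Δ : LabelledGraph W) where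
  /-- the underlying isomorphism of simplicial graphs -/
  toGraphIso : Γ.graph ≃g Δ.graph
  map_label : ∀ u v : V, Γ.graph.Adj u v →
    Δ.label (toGraphIso u) (toGraphIso v) = Γ.label u v

/-- The labelled subgraph spanned by a set of vertices. -/
def induce {V : Type*} (Γ : LabelledGraph V) (A : Set V) : LabelledGraph A where
  graph := Γ.graph.induce A
  label u v := Γ.label u v
  label_symm u v h := Γ.label_symm u v h

/-- The vertex set of the star of `v`: the vertex `v` and all its neighbours. -/
def starSet {V : Type*} (Γ : LabelledGraph V) (v : V) : Set V :=
  {u | u = v ∨ Γ.graph.Adj v u}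

/-- The star of the vertex `v`, as a labelled graph. -/
def star {V : Type*} (Γ : LabelledGraph V) (v : V) : LabelledGraph (Γ.starSet v) :=
  Γ.induce (Γ.starSet v)

/-- A labelled graph is star-regular if all its vertex stars are isomorphic as labelled graphs. -/
def StarRegular {V : Type*} (Γ : LabelledGraph V) : Prop :=
  ∀ u v : V, Nonempty ((Γ.star u).Iso (Γ.star v))

/-- A labelled graph is triangle-free if no three of its vertices span a complete graph. -/
def TriangleFree {V : Type*} (Γ : LabelledGraph V) : Prop :=
  Γ.graph.CliqueFree 3

end LabelledGraph

namespace CoxeterMatrix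

/-- The labelled graph of a Coxeter matrix `m`: distinct generators `s`, `t` are joined by an edge
exactly if `m s t ≠ 0` (that is, if there is a relation between them), and this edge has the
label `m s t`. -/
def labelledGraph {S : Type*} (M : CoxeterMatrix S) : LabelledGraph S where
  graph :=
    { Adj := fun s t => s ≠ t ∧ M s t ≠ 0
      symm := ⟨fun s t h => ⟨h.1.symm, by rw [M.symmetric t s]; exact h.2⟩⟩
      loopless := ⟨fun _ h => h.1 rfl⟩ }
  label s t := M s t
  label_symm s t _ := M.symmetric s t

/-- A Coxeter matrix is even if all its off-diagonal entries are even (`0`, which encodes the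
absence of a relation, is allowed). -/
def IsEven {S : Type*} (M : CoxeterMatrix S) : Prop :=
  ∀ s t : S, s ≠ t → Even (M s t)

end CoxeterMatrix

/-- The geodesic growth function of a Coxeter system: the number of words `w` of length `r` in the
generators such that the group element represented by `w` has word length `r`. -/
noncomputable def CoxeterSystem.geodesicGrowth {S G : Type*} [Group G] {M : CoxeterMatrix S}
    (cs : CoxeterSystem M G) (r : ℕ) : ℕ :=
  Set.ncard {w : List S | w.length = r ∧ cs.length (cs.wordProd w) = r}

/-! Geodesic words are counted letter by letter: a geodesic for `w` can be prolonged by `u` exactly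
when `u` is not a right descent of `w`. The point is that, along geodesics from 1, the number of
continuations depends only on a small state of `w`.

Two distinct right descents are always adjacent, so triangle-freeness allows at most two. A
nontrivial element reached by a geodesic has either one descent `s` with no longer alternating
suffix at `s` (`IsVertexState`), or an alternating suffix of length `k ≥ 2` on an edge labelled `m`
(`IsEdgeState`). Appending `u` extends this suffix, starts one of length 2 on a new edge, or leads
to a vertex state if `u` is adjacent to no descent. How many letters do each depends on `n = |S|`
and on sums over the labels at a vertex. Star-regularity makes these sums the same everywhere, and
without triangles they can be read off the star. Hence the recursion `continuationCount`.

The transitions rest on two facts: descents are detected by a cocycle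
(`isRightDescent_iff_inversionParity`), and descents within a pair of generators are decided in the
dihedral factor of a minimal coset decomposition (`IsPairMinimal.isRightDescent_mul_iff`). -/

namespace CoxeterSystem

/-! ### The reflection cocycle and right descents. -/

section Cocycle

variable {B W : Type*} [Group W] {M : CoxeterMatrix B} (cs : CoxeterSystem M W)

theorem _root_.Function.End.mul_apply {α : Type*} (f g : Function.End α) (x : α) :
    (f * g) x = f (g x) := rfl

theorem _root_.Function.End.one_apply {α : Type*} (x : α) : (1 : Function.End α) x = x := rfl

open Classical in
/-- The action of a simple reflection on `W × ZMod 2`: conjugation on the first coordinate, and a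
sign change whenever the first coordinate is the simple reflection itself. -/
noncomputable def simpleSignAction (i : B) : Function.End (W × ZMod 2) :=
  fun p => (cs.simple i * p.1 * cs.simple i, p.2 + if p.1 = cs.simple i then 1 else 0)

theorem simple_mul_zpow (i j : B) (k : ℤ) :
    cs.simple i * (cs.simple i * cs.simple j) ^ k =
      (cs.simple j * cs.simple i) ^ k * cs.simple i := by
  have h : SemiconjBy (cs.simple i) (cs.simple i * cs.simple j) (cs.simple j * cs.simple i) := by
    simp [SemiconjBy, mul_assoc]
  exact (h.zpow_right k).eq

theorem inv_simple_mul_simple (i j : B) :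
    (cs.simple i * cs.simple j)⁻¹ = cs.simple j * cs.simple i := by simp

theorem conj_pow_eq_simple_mul_iff (i j : B) (r x : W) (k : ℕ) :
    (cs.simple i * cs.simple j) ^ k * r * ((cs.simple i * cs.simple j) ^ k)⁻¹ = cs.simple j * x ↔
      r = cs.simple j * (cs.simple i * cs.simple j) ^ k * x * (cs.simple i * cs.simple j) ^ k := by
  have h := cs.simple_mul_zpow j i (-(k : ℤ))
  rw [← inv_simple_mul_simple, inv_zpow, zpow_neg, inv_inv, zpow_natCast] at h
  rw [h, mul_inv_eq_iff_eq_mul, ← eq_inv_mul_iff_mul_eq]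
  simp only [mul_assoc]

theorem simpleSignAction_mul_pow_apply (i j : B) (k : ℕ) (r : W) (e : ZMod 2) [DecidableEq W] :
    ((cs.simpleSignAction i * cs.simpleSignAction j) ^ k) (r, e) =
      ((cs.simple i * cs.simple j) ^ k * r * ((cs.simple i * cs.simple j) ^ k)⁻¹,
        e + ∑ l ∈ Finset.range (2 * k),
          if r = cs.simple j * (cs.simple i * cs.simple j) ^ l then 1 else 0) := by
  induction k with
  | zero => simp [Function.End.one_apply]
  | succ k ih =>
    have h0 := cs.conj_pow_eq_simple_mul_iff i j r 1 k
    have h1 := cs.conj_pow_eq_simple_mul_iff i j r (cs.simple i * cs.simple j) k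
    rw [mul_one, mul_one, mul_assoc (cs.simple j), ← pow_add, ← two_mul] at h0
    rw [mul_assoc (cs.simple j), ← pow_succ, mul_assoc (cs.simple j), ← pow_add,
      show k + 1 + k = 2 * k + 1 by ring] at h1
    rw [pow_succ', Function.End.mul_apply, ih, Function.End.mul_apply, mul_add, mul_one, Finset.sum_range_succ, Finset.sum_range_succ]
    set c := (cs.simple i * cs.simple j) ^ k * r * ((cs.simple i * cs.simple j) ^ k)⁻¹ with hc
    have h2 : cs.simple j * c * cs.simple j = cs.simple i ↔
        c = cs.simple j * (cs.simple i * cs.simple j) := by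
      constructor
      · intro h; rw [← h]; simp [mul_assoc]
      · intro h; rw [h]; simp [mul_assoc]
    refine Prod.ext ?_ ?_
    · simp only [simpleSignAction, hc, pow_succ']
      simp [mul_assoc]
    · simp only [simpleSignAction, h2, h0, h1]
      simp only [add_assoc]

/-- For `k = M i j`, the `2k` reflections tested for a sign change repeat with period `k`, so every
sign change occurs twice and cancels in `ZMod 2`. -/
theorem isLiftable_simpleSignAction : M.IsLiftable cs.simpleSignAction := by
  classical
  intro i j
  funext ⟨r, e⟩
  rw [cs.simpleSignAction_mul_pow_apply, cs.simple_mul_simple_pow, two_mul, Finset.sum_range_add]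
  simp only [pow_add, cs.simple_mul_simple_pow, one_mul, ← two_mul]
  simp [show (2 : ZMod 2) = 0 from rfl, Function.End.one_apply]

/-- The action of `W` on `W × ZMod 2` extending `simpleSignAction`. -/
noncomputable def signAction : W →* Function.End (W × ZMod 2) :=
  cs.lift ⟨cs.simpleSignAction, cs.isLiftable_simpleSignAction⟩

/-- The reflection cocycle: for a reflection `r`, the parity of the number of times `r` occurs in
the right inversion sequence of a word for `w`. -/
noncomputable def inversionParity (w r : W) : ZMod 2 := (cs.signAction w (r, 0)).2

theorem signAction_simple (i : B) : cs.signAction (cs.simple i) = cs.simpleSignAction i :=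
  cs.lift_apply_simple cs.isLiftable_simpleSignAction i

theorem inversionParity_simple [DecidableEq W] (i : B) (r : W) :
    cs.inversionParity (cs.simple i) r = if r = cs.simple i then 1 else 0 := by
  simp only [inversionParity, signAction_simple, simpleSignAction, zero_add]
  congr

theorem inversionParity_one (r : W) : cs.inversionParity 1 r = 0 := by
  simp [inversionParity, Function.End.one_apply]

theorem signAction_apply (w r : W) (e : ZMod 2) :
    cs.signAction w (r, e) = (w * r * w⁻¹, e + cs.inversionParity w r) := by
  classical
  induction w using cs.simple_induction_left generalizing r e with
  | one => simp [inversionParity_one, Function.End.one_apply]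
  | mul_simple_left w i ih =>
    have h : ∀ e, cs.signAction (cs.simple i * w) (r, e) =
        cs.simpleSignAction i (w * r * w⁻¹, e + cs.inversionParity w r) := by
      intro e
      rw [map_mul, Function.End.mul_apply, ih, signAction_simple]
    simp only [inversionParity, h]
    simp [simpleSignAction, mul_assoc, add_assoc]

theorem inversionParity_mul (w v r : W) :
    cs.inversionParity (w * v) r =
      cs.inversionParity v r + cs.inversionParity w (v * r * v⁻¹) := by
  conv_lhs => rw [inversionParity, map_mul, Function.End.mul_apply]
  rw [signAction_apply, signAction_apply, zero_add]

theorem mem_rightInvSeq_of_inversionParity_ne_zero (ω : List B) (r : W)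
    (h : cs.inversionParity (cs.wordProd ω) r ≠ 0) : r ∈ cs.rightInvSeq ω := by
  classical
  induction ω with
  | nil => simp [inversionParity_one] at h
  | cons i ω ih =>
    rw [wordProd_cons, inversionParity_mul, inversionParity_simple] at h
    rw [rightInvSeq, List.mem_cons]
    by_cases hr : cs.wordProd ω * r * (cs.wordProd ω)⁻¹ = cs.simple i
    · left; rw [← hr]; group
    · rw [if_neg hr, add_zero] at h
      exact Or.inr (ih h)

theorem length_mul_lt_of_inversionParity_ne_zero {w r : W} (h : cs.inversionParity w r ≠ 0) :
    cs.length (w * r) < cs.length w := by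
  obtain ⟨ω, hω, rfl⟩ := cs.exists_isReduced w
  exact (cs.isRightInversion_of_mem_rightInvSeq hω
    (cs.mem_rightInvSeq_of_inversionParity_ne_zero ω r h)).2

/-- A nonzero parity forces shortening. Conversely, the parities of `w` and `w * cs.simple i` at
`cs.simple i` differ by 1, so if that of `w` vanishes, the other element is the one that gets
shorter. -/
theorem isRightDescent_iff_inversionParity (w : W) (i : B) :
    cs.IsRightDescent w i ↔ cs.inversionParity w (cs.simple i) ≠ 0 := by
  classical
  refine ⟨fun h h0 => ?_, cs.length_mul_lt_of_inversionParity_ne_zero⟩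
  have h1 : cs.inversionParity (w * cs.simple i) (cs.simple i) ≠ 0 := by
    simp [inversionParity_mul, inversionParity_simple, h0]
  have h2 := cs.length_mul_lt_of_inversionParity_ne_zero h1
  rw [simple_mul_simple_cancel_right] at h2
  exact absurd h (by unfold IsRightDescent; omega)

theorem isRightDescent_mul_simple_of_not {w : W} {i : B} (h : ¬ cs.IsRightDescent w i) :
    cs.IsRightDescent (w * cs.simple i) i := by
  rw [isRightDescent_iff_not_isRightDescent_mul, simple_mul_simple_cancel_right]
  exact h

theorem not_isRightDescent_mul_simple_of {w : W} {i : B} (h : cs.IsRightDescent w i) :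
    ¬ cs.IsRightDescent (w * cs.simple i) i :=
  (cs.isRightDescent_iff_not_isRightDescent_mul).1 h

end Cocycle

/-! ### Dihedral subgroups, minimal coset representatives and alternating suffixes. -/

section Dihedral

variable {B W : Type*} [Group W] {M : CoxeterMatrix B} (cs : CoxeterSystem M W)

/-- In an even Coxeter system the product of two generators has the prescribed order. -/
theorem orderOf_simple_mul_simple (hM : M.IsEven) {s t : B} (hst : s ≠ t) :
    orderOf (cs.simple s * cs.simple t) = M s t := by
  classical
  let f : B → DihedralGroup (M s t) := fun u =>
    if u = s then DihedralGroup.sr 0 else if u = t then DihedralGroup.sr 1 else 1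
  have hf : M.IsLiftable f := by
    intro u v
    by_cases huv : u = v
    · subst huv
      rw [M.diagonal, pow_one]
      simp only [f]
      split_ifs <;> simp
    -- Evenness enters here: all generators other than `s`, `t` can be sent to 1, since then every
    -- remaining product of two images squares to 1 and an even exponent kills it.
    have key : ∀ x : DihedralGroup (M s t), x * x = 1 → x ^ M u v = 1 := by
      intro x hx
      obtain ⟨k, hk⟩ := hM u v huv
      rw [hk, ← two_mul, pow_mul, pow_two, hx, one_pow]
    by_cases hus : u = s
    · subst hus
      by_cases hvt : v = t
      · subst hvt
        simp [f, Ne.symm hst, DihedralGroup.r_pow]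
      · exact key _ (by simp [f, Ne.symm huv, hvt])
    · by_cases hut : u = t
      · subst hut
        by_cases hvs : v = s
        · subst hvs
          simp [f, hus, DihedralGroup.r_pow, M.symmetric u v]
        · exact key _ (by simp [f, hus, hvs, Ne.symm huv])
      · refine key _ ?_
        simp only [f, hus, hut, if_false]
        split_ifs <;> simp
  refine Nat.dvd_antisymm (orderOf_dvd_of_pow_eq_one (cs.simple_mul_simple_pow s t)) ?_
  have h := orderOf_map_dvd (cs.lift ⟨f, hf⟩) (cs.simple s * cs.simple t)
  rw [map_mul, cs.lift_apply_simple hf, cs.lift_apply_simple hf] at h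
  simpa [f, Ne.symm hst] using h

/-- The alternating product of length `k` of the generators `s` and `t`, with last factor `s`. -/
def alt (s t : B) : ℕ → W
  | 0 => 1
  | k + 1 => alt t s k * cs.simple s

theorem alt_even (s t : B) (k : ℕ) : cs.alt s t (k + k) = (cs.simple t * cs.simple s) ^ k := by
  induction k with
  | zero => simp [alt]
  | succ k ih =>
    rw [show k + 1 + (k + 1) = (k + k) + 1 + 1 by ring, alt, alt, ih, pow_succ, mul_assoc]

theorem alt_comm (hM : M.IsEven) {s t : B} (hst : s ≠ t) :
    cs.alt s t (M s t) = cs.alt t s (M s t) := by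
  obtain ⟨k, hk⟩ := hM s t hst
  have h := cs.simple_mul_simple_pow' s t
  rw [hk, pow_add] at h
  rw [hk, alt_even, alt_even, eq_inv_of_mul_eq_one_left h, ← inv_pow, inv_simple_mul_simple]

/-- The right inversions of the alternating word are `(st)^i s` for `i < k`, and two of them agree
exactly when their exponents agree modulo `M s t`. The cases `j = 0` and `j = -1` are the
reflections `s` and `t`. -/
theorem inversionParity_alt (hM : M.IsEven) {s t : B} (hst : s ≠ t) (k : ℕ) (j : ℤ) :
    cs.inversionParity (cs.alt s t k) ((cs.simple s * cs.simple t) ^ j * cs.simple s) =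
      ∑ i ∈ Finset.range k, if (M s t : ℤ) ∣ i - j then 1 else 0 := by
  classical
  induction k generalizing s t j with
  | zero => simp [alt, inversionParity_one]
  | succ k ih =>
    have h1 : (cs.simple s * cs.simple t) ^ j * cs.simple s = cs.simple s ↔ (M s t : ℤ) ∣ 0 - j := by
      rw [mul_eq_right, zero_sub, dvd_neg, ← cs.orderOf_simple_mul_simple hM hst,
        orderOf_dvd_iff_zpow_eq_one]
    have h2 : cs.simple s * ((cs.simple s * cs.simple t) ^ j * cs.simple s) * (cs.simple s)⁻¹ =
        (cs.simple t * cs.simple s) ^ (j - 1) * cs.simple t := by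
      rw [← mul_assoc, mul_inv_cancel_right, simple_mul_zpow, zpow_sub_one]
      simp [mul_assoc]
    rw [alt, inversionParity_mul, inversionParity_simple, h2, ih hst.symm, Finset.sum_range_succ',
      M.symmetric t s, add_comm, if_congr h1 rfl rfl]
    push_cast
    congr 1
    refine Finset.sum_congr rfl fun i _ => ?_
    rw [show (i : ℤ) + 1 - j = i - (j - 1) by ring]

theorem isRightDescent_alt_left (hM : M.IsEven) {s t : B} (hst : s ≠ t) {k : ℕ} (hk : k ≠ 0)
    (hkm : k ≤ M s t ∨ M s t = 0) : cs.IsRightDescent (cs.alt s t k) s := by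
  have h := cs.inversionParity_alt hM hst k 0
  rw [zpow_zero, one_mul] at h
  rw [isRightDescent_iff_inversionParity, h, Finset.sum_eq_single 0]
  · simp
  · intro i hi hi0
    rw [Finset.mem_range] at hi
    rw [if_neg]
    intro hd
    rw [sub_zero, Int.natCast_dvd_natCast] at hd
    have := Nat.le_of_dvd (Nat.pos_of_ne_zero hi0) hd
    rcases hkm with h | h
    · omega
    · rw [h, zero_dvd_iff] at hd; exact hi0 hd
  · intro h0; simp at h0; exact absurd h0 hk

theorem not_isRightDescent_alt_right (hM : M.IsEven) {s t : B} (hst : s ≠ t) {k : ℕ}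
    (hkm : k < M s t ∨ M s t = 0) : ¬ cs.IsRightDescent (cs.alt s t k) t := by
  have h := cs.inversionParity_alt hM hst k (-1)
  rw [zpow_neg_one, inv_simple_mul_simple, simple_mul_simple_cancel_right] at h
  rw [isRightDescent_iff_inversionParity, h, not_not]
  refine Finset.sum_eq_zero fun i hi => if_neg fun hd => ?_
  rw [Finset.mem_range] at hi
  rw [sub_neg_eq_add, show (i : ℤ) + 1 = ((i + 1 : ℕ) : ℤ) by simp, Int.natCast_dvd_natCast] at hd
  have := Nat.le_of_dvd (Nat.succ_pos i) hd
  rcases hkm with h | h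
  · omega
  · rw [h, zero_dvd_iff] at hd; omega

/-- The subgroup generated by two generators. -/
def pairSubgroup (s t : B) : Subgroup W := Subgroup.closure {cs.simple s, cs.simple t}

theorem pairSubgroup_comm (s t : B) : cs.pairSubgroup s t = cs.pairSubgroup t s := by
  rw [pairSubgroup, pairSubgroup, Set.pair_comm]

theorem simple_left_mem_pairSubgroup (s t : B) : cs.simple s ∈ cs.pairSubgroup s t :=
  Subgroup.subset_closure (by simp)

theorem alt_mem_pairSubgroup (s t : B) (k : ℕ) : cs.alt s t k ∈ cs.pairSubgroup s t := by
  induction k generalizing s t with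
  | zero => exact one_mem _
  | succ k ih =>
    refine mul_mem ?_ (cs.simple_left_mem_pairSubgroup s t)
    rw [pairSubgroup_comm]
    exact ih t s

theorem exists_alt_mul_simple (hM : M.IsEven) {s t : B} (hst : s ≠ t) {k : ℕ}
    (hkm : k ≤ M s t ∨ M s t = 0) {a : B} (ha : a = s ∨ a = t) :
    ∃ l, (l ≤ M s t ∨ M s t = 0) ∧ (cs.alt s t k * cs.simple a = cs.alt s t l ∨
      cs.alt s t k * cs.simple a = cs.alt t s l) := by
  rcases ha with rfl | rfl
  · cases k with
    | zero =>
      have : M a t ≠ 1 := fun h => by have := hM a t hst; rw [h] at this; simp at this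
      exact ⟨1, by omega, Or.inl rfl⟩
    | succ k => exact ⟨k, by omega, Or.inr (by simp [alt])⟩
  · by_cases hk : k < M s a ∨ M s a = 0
    · exact ⟨k + 1, by omega, Or.inr rfl⟩
    -- At maximal length both alternating words represent the same element, so the one ending in `a`
    -- can be chosen and its last letter cancelled.
    · have hk : k = M s a := by omega
      rw [hk, alt_comm cs hM hst]
      obtain ⟨l, hl⟩ : ∃ l, M s a = l + 1 := Nat.exists_eq_succ_of_ne_zero (by omega)
      exact ⟨l, by omega, Or.inl (by rw [hl]; simp [alt])⟩

theorem exists_eq_alt_of_mem_pairSubgroup (hM : M.IsEven) {s t : B} (hst : s ≠ t) {h : W}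
    (hh : h ∈ cs.pairSubgroup s t) :
    ∃ k, (k ≤ M s t ∨ M s t = 0) ∧ (h = cs.alt s t k ∨ h = cs.alt t s k) := by
  have step : ∀ x y : W, (∃ k, (k ≤ M s t ∨ M s t = 0) ∧ (x = cs.alt s t k ∨ x = cs.alt t s k)) →
      y ∈ ({cs.simple s, cs.simple t} : Set W) →
      ∃ k, (k ≤ M s t ∨ M s t = 0) ∧ (x * y = cs.alt s t k ∨ x * y = cs.alt t s k) := by
    rintro x y ⟨k, hk, hx⟩ hy
    obtain ⟨a, ha, rfl⟩ : ∃ a, (a = s ∨ a = t) ∧ y = cs.simple a := by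
      rcases hy with rfl | rfl
      · exact ⟨s, Or.inl rfl, rfl⟩
      · exact ⟨t, Or.inr rfl, rfl⟩
    rcases hx with rfl | rfl
    · exact cs.exists_alt_mul_simple hM hst hk ha
    · rw [M.symmetric s t] at hk ⊢
      obtain ⟨l, hl, hl'⟩ := cs.exists_alt_mul_simple hM hst.symm hk ha.symm
      exact ⟨l, hl, hl'.symm⟩
  induction hh using Subgroup.closure_induction_right with
  | one => exact ⟨0, by omega, Or.inl rfl⟩
  | mul_right x _ y hy ih => exact step x y ih hy
  | mul_inv_cancel x _ y hy ih =>
    refine step x y⁻¹ ih ?_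
    rcases hy with rfl | rfl <;> simp

/-- `w` is of minimal length in its left coset of the subgroup generated by `s` and `t`. -/
def IsPairMinimal (w : W) (s t : B) : Prop :=
  ∀ h ∈ cs.pairSubgroup s t, cs.length w ≤ cs.length (w * h)

/-- `w` is the product of an element of minimal length in its left coset of the subgroup generated
by `s` and `t`, and the alternating product of length `k` ending in `s`. -/
def HasAltSuffix (w : W) (s t : B) (k : ℕ) : Prop :=
  ∃ y, cs.IsPairMinimal y s t ∧ w = y * cs.alt s t k

variable {cs}

/-- By the cocycle identity the two parities differ by that of `y` at a conjugate of `a` inside the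
pair subgroup. Were it nonzero, `y` could be shortened within its coset. -/
theorem IsPairMinimal.isRightDescent_mul_iff {y h : W} {s t a : B} (hy : cs.IsPairMinimal y s t)
    (hh : h ∈ cs.pairSubgroup s t) (ha : cs.simple a ∈ cs.pairSubgroup s t) :
    cs.IsRightDescent (y * h) a ↔ cs.IsRightDescent h a := by
  rw [isRightDescent_iff_inversionParity, isRightDescent_iff_inversionParity, inversionParity_mul]
  have h0 : cs.inversionParity y (h * cs.simple a * h⁻¹) = 0 := by
    by_contra h1
    exact absurd (cs.length_mul_lt_of_inversionParity_ne_zero h1)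
      (hy _ (mul_mem (mul_mem hh ha) (inv_mem hh))).not_gt
  rw [h0, add_zero]

theorem IsPairMinimal.symm {y : W} {s t : B} (hy : cs.IsPairMinimal y s t) :
    cs.IsPairMinimal y t s := by
  unfold IsPairMinimal
  rw [pairSubgroup_comm]
  exact hy

theorem HasAltSuffix.mul_simple {w : W} {s t : B} {k : ℕ} (h : cs.HasAltSuffix w s t k) :
    cs.HasAltSuffix (w * cs.simple t) t s (k + 1) := by
  obtain ⟨y, hy, rfl⟩ := h
  exact ⟨y, hy.symm, by rw [alt, mul_assoc]⟩

theorem HasAltSuffix.mul_simple_cancel {w : W} {s t : B} {k : ℕ}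
    (h : cs.HasAltSuffix w s t (k + 1)) : cs.HasAltSuffix (w * cs.simple s) t s k := by
  obtain ⟨y, hy, rfl⟩ := h
  exact ⟨y, hy.symm, by simp [alt, mul_assoc]⟩

theorem HasAltSuffix.isRightDescent {w : W} {s t : B} {k : ℕ} (h : cs.HasAltSuffix w s t k)
    (hM : M.IsEven) (hst : s ≠ t) (hk : k ≠ 0) (hkm : k ≤ M s t ∨ M s t = 0) :
    cs.IsRightDescent w s := by
  obtain ⟨y, hy, rfl⟩ := h
  rw [hy.isRightDescent_mul_iff (cs.alt_mem_pairSubgroup s t k)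
    (cs.simple_left_mem_pairSubgroup s t)]
  exact cs.isRightDescent_alt_left hM hst hk hkm

theorem HasAltSuffix.not_isRightDescent {w : W} {s t : B} {k : ℕ} (h : cs.HasAltSuffix w s t k)
    (hM : M.IsEven) (hst : s ≠ t) (hkm : k < M s t ∨ M s t = 0) :
    ¬ cs.IsRightDescent w t := by
  obtain ⟨y, hy, rfl⟩ := h
  rw [hy.isRightDescent_mul_iff (cs.alt_mem_pairSubgroup s t k)
    (by rw [pairSubgroup_comm]; exact cs.simple_left_mem_pairSubgroup t s)]
  exact cs.not_isRightDescent_alt_right hM hst hkm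

theorem HasAltSuffix.isRightDescent_right {w : W} {s t : B} (h : cs.HasAltSuffix w s t (M s t))
    (hM : M.IsEven) (hst : s ≠ t) (hm : M s t ≠ 0) : cs.IsRightDescent w t := by
  obtain ⟨y, hy, rfl⟩ := h
  have h' : cs.HasAltSuffix (y * cs.alt s t (M s t)) t s (M s t) :=
    ⟨y, hy.symm, by rw [alt_comm cs hM hst]⟩
  exact h'.isRightDescent hM hst.symm hm (Or.inl (M.symmetric s t).le)

variable (cs)

theorem exists_isPairMinimal (w : W) (s t : B) :
    ∃ y, cs.IsPairMinimal y s t ∧ ∃ h ∈ cs.pairSubgroup s t, w = y * h := by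
  classical
  have hex : ∃ n, ∃ h ∈ cs.pairSubgroup s t, cs.length (w * h) = n := ⟨_, 1, one_mem _, rfl⟩
  obtain ⟨h, hh, hl⟩ := Nat.find_spec hex
  refine ⟨w * h, fun g hg => ?_, h⁻¹, inv_mem hh, by group⟩
  rw [hl, mul_assoc]
  exact Nat.find_min' hex ⟨h * g, mul_mem hh hg, rfl⟩

theorem exists_hasAltSuffix (hM : M.IsEven) {s t : B} (hst : s ≠ t) (w : W) :
    ∃ k, (k ≤ M s t ∨ M s t = 0) ∧ (cs.HasAltSuffix w s t k ∨ cs.HasAltSuffix w t s k) := by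
  obtain ⟨y, hy, h, hh, rfl⟩ := cs.exists_isPairMinimal w s t
  obtain ⟨k, hk, rfl | rfl⟩ := cs.exists_eq_alt_of_mem_pairSubgroup hM hst hh
  · exact ⟨k, hk, Or.inl ⟨y, hy, rfl⟩⟩
  · exact ⟨k, hk, Or.inr ⟨y, hy.symm, rfl⟩⟩

theorem hasAltSuffix_zero (hM : M.IsEven) {s t : B} (hst : s ≠ t) {w : W}
    (hs : ¬ cs.IsRightDescent w s) (ht : ¬ cs.IsRightDescent w t) :
    cs.HasAltSuffix w s t 0 := by
  obtain ⟨k, hk, h | h⟩ := cs.exists_hasAltSuffix hM hst w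
  · by_cases hk0 : k = 0
    · rwa [hk0] at h
    · exact absurd (h.isRightDescent hM hst hk0 hk) hs
  · by_cases hk0 : k = 0
    · rw [hk0] at h
      obtain ⟨y, hy, rfl⟩ := h
      exact ⟨y, hy.symm, rfl⟩
    · rw [M.symmetric s t] at hk
      exact absurd (h.isRightDescent hM hst.symm hk0 hk) ht

theorem hasAltSuffix_one (hM : M.IsEven) {s t : B} (hst : s ≠ t) {w : W}
    (hs : cs.IsRightDescent w s) (ht : ¬ cs.IsRightDescent (w * cs.simple s) t) :
    cs.HasAltSuffix w s t 1 := by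
  have h := (cs.hasAltSuffix_zero hM hst.symm ht (cs.not_isRightDescent_mul_simple_of hs)).mul_simple
  rwa [simple_mul_simple_cancel_right] at h

theorem ne_zero_of_isRightDescent (hM : M.IsEven) {s t : B} (hst : s ≠ t) {w : W}
    (hs : cs.IsRightDescent w s) (ht : cs.IsRightDescent w t) : M s t ≠ 0 := by
  intro h0
  obtain ⟨k, _, h | h⟩ := cs.exists_hasAltSuffix hM hst w
  · exact h.not_isRightDescent hM hst (Or.inr h0) ht
  · exact h.not_isRightDescent hM hst.symm (Or.inr (by rw [M.symmetric, h0])) hs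

/-- Otherwise the alternating suffix of `w` has length exactly 1, which is not maximal, so `t` could
not be a descent of `w`. -/
theorem isRightDescent_mul_simple_of_ne (hM : M.IsEven) {s t : B} (hst : s ≠ t) {w : W}
    (hs : cs.IsRightDescent w s) (ht : cs.IsRightDescent w t) :
    cs.IsRightDescent (w * cs.simple s) t := by
  by_contra h
  have : M s t ≠ 1 := fun h => by have := hM s t hst; rw [h] at this; simp at this
  exact (cs.hasAltSuffix_one hM hst hs h).not_isRightDescent hM hst (by omega) ht

end Dihedral

end CoxeterSystem

/-! ### States of elements and transitions between them. -/

namespace CoxeterSystem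

section Transitions

variable {B W : Type*} [Group W] {M : CoxeterMatrix B} (cs : CoxeterSystem M W)

/-- `s` is the only right descent of `w`, and no neighbour of `s` is a right descent of `w s`. -/
def IsVertexState (w : W) (s : B) : Prop :=
  (∀ v, cs.IsRightDescent w v ↔ v = s) ∧
    ∀ v, M.labelledGraph.graph.Adj s v → ¬ cs.IsRightDescent (w * cs.simple s) v

/-- `w` ends in an alternating product of length `k` of the adjacent generators `s`, `t`, with
last factor `s`, and its right descents are `s` and, if `k` is maximal, also `t`. -/
def IsEdgeState (w : W) (s t : B) (k : ℕ) : Prop :=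
  M.labelledGraph.graph.Adj s t ∧ 2 ≤ k ∧ k ≤ M s t ∧ cs.HasAltSuffix w s t k ∧
    ∀ v, cs.IsRightDescent w v ↔ v = s ∨ (v = t ∧ k = M s t)

variable {cs}

theorem not_adj_of_triangleFree (hT : M.labelledGraph.TriangleFree) {a b c : B}
    (hab : M.labelledGraph.graph.Adj a b) (hac : M.labelledGraph.graph.Adj a c) :
    ¬ M.labelledGraph.graph.Adj b c := by
  classical
  intro hbc
  exact hT {a, b, c} (SimpleGraph.is3Clique_triple_iff.2 ⟨hab, hac, hbc⟩)

theorem adj_of_isRightDescent (hM : M.IsEven) {w : W} {s t : B} (hst : s ≠ t)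
    (hs : cs.IsRightDescent w s) (ht : cs.IsRightDescent w t) : M.labelledGraph.graph.Adj s t :=
  ⟨hst, cs.ne_zero_of_isRightDescent hM hst hs ht⟩

theorem isRightDescent_of_mul_simple (hM : M.IsEven) {w : W} {u v : B} (huv : v ≠ u)
    (hu : ¬ cs.IsRightDescent w u) (hv : cs.IsRightDescent (w * cs.simple u) v) :
    cs.IsRightDescent w v ∧ M.labelledGraph.graph.Adj u v := by
  have hu' := cs.isRightDescent_mul_simple_of_not hu
  have h := cs.isRightDescent_mul_simple_of_ne hM huv.symm hu' hv
  rw [simple_mul_simple_cancel_right] at h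
  exact ⟨h, adj_of_isRightDescent hM huv.symm hu' hv⟩

theorem isVertexState_mul_simple (hM : M.IsEven) {w : W} {u : B} (hu : ¬ cs.IsRightDescent w u)
    (h : ∀ v, cs.IsRightDescent w v → ¬ M.labelledGraph.graph.Adj u v) :
    cs.IsVertexState (w * cs.simple u) u := by
  refine ⟨fun v => ⟨fun hv => ?_, ?_⟩, fun v huv hv => ?_⟩
  · by_contra hne
    have := isRightDescent_of_mul_simple hM hne hu hv
    exact h v this.1 this.2
  · rintro rfl
    exact cs.isRightDescent_mul_simple_of_not hu
  · rw [simple_mul_simple_cancel_right] at hv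
    exact h v hv huv

theorem isEdgeState_mul_simple (hM : M.IsEven) (hT : M.labelledGraph.TriangleFree) {w : W}
    {s t : B} {k : ℕ} (hst : M.labelledGraph.graph.Adj s t) (hs : cs.IsRightDescent w s)
    (ht : ¬ cs.IsRightDescent w t) (hw : cs.HasAltSuffix w s t k) (hk : 1 ≤ k) (hkm : k < M s t) :
    cs.IsEdgeState (w * cs.simple t) t s (k + 1) := by
  have hw' := hw.mul_simple
  rw [IsEdgeState, M.symmetric t s]
  refine ⟨hst.symm, by omega, hkm, hw', fun v => ⟨fun hv => ?_, ?_⟩⟩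
  · by_cases hvt : v = t
    · exact Or.inl hvt
    obtain ⟨hvw, hvt'⟩ := isRightDescent_of_mul_simple hM hvt ht hv
    by_cases hvs : v = s
    · subst hvs
      refine Or.inr ⟨rfl, ?_⟩
      by_contra hne
      exact hw'.not_isRightDescent hM hst.1.symm (by rw [M.symmetric t v]; omega) hv
    -- A third descent `v` would be adjacent to `s`, both being descents of `w`, and to `t`, closing
    -- a triangle.
    · exact absurd hvt'.symm
        (not_adj_of_triangleFree hT (adj_of_isRightDescent hM (Ne.symm hvs) hs hvw) hst)
  · rintro (rfl | ⟨rfl, h⟩)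
    · exact cs.isRightDescent_mul_simple_of_not ht
    · rw [h, M.symmetric v t] at hw'
      exact hw'.isRightDescent_right hM hst.1.symm (by rw [M.symmetric t v]; omega)

theorem one_lt_of_adj (hM : M.IsEven) {s t : B} (hst : M.labelledGraph.graph.Adj s t) :
    1 < M s t := by
  have h0 : M s t ≠ 0 := hst.2
  obtain ⟨k, hk⟩ := hM s t hst.1
  omega

theorem isEdgeState_two_mul_simple (hM : M.IsEven) (hT : M.labelledGraph.TriangleFree) {w : W}
    {s u : B} (hsu : M.labelledGraph.graph.Adj s u) (hs : cs.IsRightDescent w s)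
    (hu : ¬ cs.IsRightDescent w u) (hu' : ¬ cs.IsRightDescent (w * cs.simple s) u) :
    cs.IsEdgeState (w * cs.simple u) u s 2 :=
  isEdgeState_mul_simple hM hT hsu hs hu (cs.hasAltSuffix_one hM hsu.1 hs hu') le_rfl
    (one_lt_of_adj hM hsu)

theorem IsEdgeState.isRightDescent_mul_simple {w : W} {s t : B} {k : ℕ}
    (h : cs.IsEdgeState w s t k) (hM : M.IsEven) : cs.IsRightDescent (w * cs.simple s) t := by
  obtain ⟨hst, hk, hkm, hw, -⟩ := h
  obtain ⟨k, rfl⟩ : ∃ j, k = j + 1 := ⟨k - 1, by omega⟩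
  exact hw.mul_simple_cancel.isRightDescent hM hst.1.symm (by omega)
    (Or.inl (by rw [M.symmetric t s]; omega))

theorem IsEdgeState.isEdgeState_two_mul_simple {w : W} {s t u : B} {k : ℕ}
    (h : cs.IsEdgeState w s t k) (hM : M.IsEven) (hT : M.labelledGraph.TriangleFree)
    (hsu : M.labelledGraph.graph.Adj s u) (hut : u ≠ t) :
    cs.IsEdgeState (w * cs.simple u) u s 2 := by
  have hst := h.1
  have hs : cs.IsRightDescent w s := (h.2.2.2.2 s).2 (Or.inl rfl)
  refine CoxeterSystem.isEdgeState_two_mul_simple hM hT hsu hs (fun hu => ?_) (fun hu => ?_)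
  · rcases (h.2.2.2.2 u).1 hu with rfl | hu
    · exact hsu.1 rfl
    · exact hut hu.1
  -- Removing `s` leaves `t` as a descent. If `u` were one too, `s`, `t`, `u` would be a triangle.
  · exact not_adj_of_triangleFree hT hst hsu
      (adj_of_isRightDescent hM hut.symm (h.isRightDescent_mul_simple hM) hu)

theorem IsEdgeState.symm {w : W} {s t : B} (h : cs.IsEdgeState w s t (M s t)) (hM : M.IsEven) :
    cs.IsEdgeState w t s (M t s) := by
  obtain ⟨hst, hk, hkm, ⟨y, hy, rfl⟩, hd⟩ := h
  refine ⟨hst.symm, by rwa [M.symmetric t s], le_rfl, ⟨y, hy.symm, ?_⟩, fun v => ?_⟩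
  · rw [alt_comm cs hM hst.1, M.symmetric t s]
  · rw [hd]
    simp [or_comm]

end Transitions

/-! ### Counting geodesic continuations by their first letter. -/

section Counting

variable {B W : Type*} [Group W] {M : CoxeterMatrix B} (cs : CoxeterSystem M W)

/-- The words of length `r` that prolong each geodesic from `1` to `w` to a geodesic. -/
def geodesicContinuations (w : W) (r : ℕ) : Set (List B) :=
  {ω | ω.length = r ∧ cs.length (w * cs.wordProd ω) = cs.length w + r}

theorem cons_mem_geodesicContinuations (w : W) (r : ℕ) (u : B) (ω : List B) :
    u :: ω ∈ cs.geodesicContinuations w (r + 1) ↔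
      ¬ cs.IsRightDescent w u ∧ ω ∈ cs.geodesicContinuations (w * cs.simple u) r := by
  simp only [geodesicContinuations, Set.mem_ofPred_eq, List.length_cons, wordProd_cons,
    Nat.add_right_cancel_iff, not_isRightDescent_iff, ← mul_assoc]
  constructor
  · rintro ⟨rfl, h⟩
    have h1 := cs.length_mul_le (w * cs.simple u) (cs.wordProd ω)
    have h2 := cs.length_wordProd_le ω
    have h3 := cs.length_mul_simple w u
    omega
  · rintro ⟨h, rfl, h'⟩
    omega

theorem finite_geodesicContinuations [Finite B] (w : W) (r : ℕ) :
    (cs.geodesicContinuations w r).Finite :=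
  (List.finite_length_eq B r).subset fun _ h => h.1

theorem ncard_geodesicContinuations_zero (w : W) : (cs.geodesicContinuations w 0).ncard = 1 := by
  have : cs.geodesicContinuations w 0 = {[]} := by
    ext ω
    simp only [geodesicContinuations, Set.mem_ofPred_eq, List.length_eq_zero_iff,
      Set.mem_singleton_iff]
    exact ⟨fun h => h.1, fun h => ⟨h, by simp [h]⟩⟩
  rw [this, Set.ncard_singleton]

open Classical in
theorem ncard_geodesicContinuations_succ [Fintype B] (w : W) (r : ℕ) :
    (cs.geodesicContinuations w (r + 1)).ncard =
      ∑ u, if cs.IsRightDescent w u then 0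
        else (cs.geodesicContinuations (w * cs.simple u) r).ncard := by
  have h : cs.geodesicContinuations w (r + 1) =
      ⋃ u : B, if cs.IsRightDescent w u then ∅
        else List.cons u '' cs.geodesicContinuations (w * cs.simple u) r := by
    ext ω
    cases ω with
    | nil =>
      simp only [geodesicContinuations, Set.mem_ofPred_eq, List.length_nil, Set.mem_iUnion]
      refine ⟨fun h => by omega, fun ⟨u, hu⟩ => ?_⟩
      split_ifs at hu <;> simp at hu
    | cons u ω =>
      rw [cons_mem_geodesicContinuations, Set.mem_iUnion]
      constructor
      · rintro ⟨h1, h2⟩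
        exact ⟨u, by rw [if_neg h1]; exact ⟨ω, h2, rfl⟩⟩
      · rintro ⟨v, hv⟩
        split_ifs at hv with hd
        · exact absurd hv (Set.notMem_empty _)
        · obtain ⟨ω', h1, h2⟩ := hv
          rw [List.cons.injEq] at h2
          obtain ⟨rfl, rfl⟩ := h2
          exact ⟨hd, h1⟩
  rw [h, Set.ncard_iUnion_of_finite, finsum_eq_sum_of_fintype]
  · refine Finset.sum_congr rfl fun u _ => ?_
    split_ifs
    · simp
    · exact Set.ncard_image_of_injective _ (List.cons_injective)
  · intro u
    split_ifs
    · exact Set.finite_empty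
    · exact (cs.finite_geodesicContinuations _ _).image _
  · intro u v huv
    refine Set.disjoint_left.2 fun ω hu hv => ?_
    dsimp only at hu hv
    split_ifs at hu hv
    all_goals first | exact hu | exact hv | skip
    obtain ⟨_, _, rfl⟩ := hu
    obtain ⟨_, _, h⟩ := hv
    rw [List.cons.injEq] at h
    exact huv h.1.symm

end Counting

end CoxeterSystem

/-! ### Label sums over the edges of a star. -/

open Classical in
/-- Half of the sum of `h (label u v)` over all ordered pairs of adjacent vertices `u`, `v`; that
is, the sum of `h` over the labels of the edges. -/
noncomputable def LabelledGraph.edgeSum {V : Type*} (Γ : LabelledGraph V) (h : ℕ → ℤ) : ℤ :=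
  (∑ᶠ p : V × V, if Γ.graph.Adj p.1 p.2 then h (Γ.label p.1 p.2) else 0) / 2

theorem LabelledGraph.Iso.edgeSum_eq {V W : Type*} {Γ : LabelledGraph V} {Δ : LabelledGraph W}
    (φ : Γ.Iso Δ) : Γ.edgeSum = Δ.edgeSum := by
  classical
  funext h
  unfold LabelledGraph.edgeSum
  congr 1
  rw [← finsum_comp_equiv (φ.toGraphIso.toEquiv.prodCongr φ.toGraphIso.toEquiv)]
  refine finsum_congr fun p => ?_
  by_cases hp : Γ.graph.Adj p.1 p.2
  · have hp' : Δ.graph.Adj (φ.toGraphIso p.1) (φ.toGraphIso p.2) := φ.toGraphIso.map_adj_iff.2 hp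
    simp only [Equiv.prodCongr_apply, Prod.map, RelIso.coe_fn_toEquiv]
    rw [if_pos hp, if_pos hp', φ.map_label _ _ hp]
  · have hp' : ¬ Δ.graph.Adj (φ.toGraphIso p.1) (φ.toGraphIso p.2) :=
      fun h' => hp (φ.toGraphIso.map_adj_iff.1 h')
    simp only [Equiv.prodCongr_apply, Prod.map, RelIso.coe_fn_toEquiv]
    rw [if_neg hp, if_neg hp']

-- Without triangles, all edges of the star pass through its centre. Each is met twice among ordered
-- pairs, hence the division by 2 is exact.
open Classical in
theorem LabelledGraph.edgeSum_star {V : Type*} [Fintype V] (Γ : LabelledGraph V)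
    (hT : Γ.TriangleFree) (s : V) (h : ℕ → ℤ) :
    (Γ.star s).edgeSum h = ∑ u, if Γ.graph.Adj s u then h (Γ.label s u) else 0 := by
  have key : ∀ a b : V,
      (if a ∈ Γ.starSet s then (if b ∈ Γ.starSet s then
        (if Γ.graph.Adj a b then h (Γ.label a b) else 0) else 0) else 0) =
      (if a = s then (if Γ.graph.Adj s b then h (Γ.label s b) else 0) else 0) +
      (if b = s then (if Γ.graph.Adj s a then h (Γ.label s a) else 0) else 0) := by
    intro a b
    simp only [LabelledGraph.starSet, Set.mem_ofPred_eq]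
    by_cases ha : a = s
    · subst ha
      by_cases hb : b = a
      · simp [hb]
      · by_cases hab : Γ.graph.Adj a b <;> simp [hb, hab]
    · by_cases hb : b = s
      · subst hb
        by_cases hab : Γ.graph.Adj b a
        · simp [ha, hab, hab.symm, Γ.label_symm b a hab]
        · simp [ha, hab]
      · by_cases h1 : Γ.graph.Adj s a
        · by_cases h2 : Γ.graph.Adj s b
          · have h3 : ¬ Γ.graph.Adj a b := fun h3 =>
              hT {s, a, b} (SimpleGraph.is3Clique_triple_iff.2 ⟨h1, h2, h3⟩)
            simp [ha, hb, h3]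
          · simp [ha, hb, h2]
        · simp [ha, hb, h1]
  have hsum : ∀ f : V → ℤ, ∑ a : Γ.starSet s, f a = ∑ a, if a ∈ Γ.starSet s then f a else 0 := by
    intro f
    rw [← Finset.sum_filter]
    exact (Finset.sum_subtype _ (by simp) f).symm
  rw [LabelledGraph.edgeSum, finsum_eq_sum_of_fintype, Fintype.sum_prod_type]
  change (∑ a : Γ.starSet s, ∑ b : Γ.starSet s,
    if Γ.graph.Adj a b then h (Γ.label a b) else 0) / 2 = _
  rw [Finset.sum_congr rfl fun (a : Γ.starSet s) _ =>
    hsum fun b => if Γ.graph.Adj a b then h (Γ.label a b) else 0]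
  rw [hsum fun a => ∑ b, if b ∈ Γ.starSet s then
    (if Γ.graph.Adj a b then h (Γ.label a b) else 0) else 0]
  have : ∀ a : V, (if a ∈ Γ.starSet s then ∑ b, (if b ∈ Γ.starSet s then
      (if Γ.graph.Adj a b then h (Γ.label a b) else 0) else 0) else 0) =
      ∑ b, ((if a = s then (if Γ.graph.Adj s b then h (Γ.label s b) else 0) else 0) +
      (if b = s then (if Γ.graph.Adj s a then h (Γ.label s a) else 0) else 0)) := by
    intro a
    simp only [← key]
    split_ifs <;> simp
  simp only [this, Finset.sum_add_distrib]
  rw [Finset.sum_comm]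
  simp only [Finset.sum_ite_eq', Finset.mem_univ, if_true]
  omega

/-! ### The recursion for the number of continuations. -/

/-- The numbers of geodesic continuations in terms of the number `n` of generators and the sums
`H h` of `h` over the labels of the edges at a vertex. The state `none` stands for an element with
a single right descent `s` which does not end in a longer alternating product of `s` and one of its
neighbours, and `some (m, k)` for an element ending in an alternating product of length `k ≥ 2`
of the endpoints of an edge with label `m`. -/
def continuationCount (n : ℤ) (H : (ℕ → ℤ) → ℤ) : ℕ → Option (ℕ × ℕ) → ℤ
  | 0, _ => 1
  | r + 1, none =>
    (n - 1 - H fun _ => 1) * continuationCount n H r none +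
      H fun m => continuationCount n H r (some (m, 2))
  | r + 1, some (m, k) =>
    if k < m then
      (n - 1 - H fun _ => 1) * continuationCount n H r none +
        (H fun m => continuationCount n H r (some (m, 2))) -
        continuationCount n H r (some (m, 2)) + continuationCount n H r (some (m, k + 1))
    else
      -- With `d = H 1`, both ends of the edge are descents and have `d - 1` further neighbours
      -- each, disjoint for lack of triangles. This leaves `n - 2 - 2 * (d - 1) = n - 2 * d` letters
      -- leading to a vertex state.
      (n - 2 * H fun _ => 1) * continuationCount n H r none +
        2 * ((H fun m => continuationCount n H r (some (m, 2))) -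
          continuationCount n H r (some (m, 2)))

/-- The number of geodesics of each length, in terms of the number `n` of generators and the sums
`H h` of `h` over the labels of the edges at a vertex. -/
def geodesicCount (n : ℤ) (H : (ℕ → ℤ) → ℤ) : ℕ → ℤ
  | 0 => 1
  | r + 1 => n * continuationCount n H r none

namespace CoxeterSystem

variable {B W : Type*} [Group W] {M : CoxeterMatrix B} (cs : CoxeterSystem M W)

open Classical in
theorem ncard_geodesicContinuations_succ_eq_sum [Fintype B] (w : W) (r : ℕ) (F : B → ℤ)
    (hF : ∀ u, F u = if cs.IsRightDescent w u then 0
        else ((cs.geodesicContinuations (w * cs.simple u) r).ncard : ℤ)) :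
    ((cs.geodesicContinuations w (r + 1)).ncard : ℤ) = ∑ u, F u := by
  rw [ncard_geodesicContinuations_succ]
  push_cast
  exact Finset.sum_congr rfl fun u _ => (hF u).symm

open Classical in
/-- The number of continuations of length `r` of an element only depends on its state. -/
theorem ncard_geodesicContinuations_eq [Fintype B] (hM : M.IsEven)
    (hT : M.labelledGraph.TriangleFree) {n : ℤ} (hn : (Fintype.card B : ℤ) = n)
    (H : (ℕ → ℤ) → ℤ)
    (hH : ∀ s h, ∑ u, (if M.labelledGraph.graph.Adj s u then h (M s u) else 0) = H h) (r : ℕ) :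
    (∀ w s, cs.IsVertexState w s → ((cs.geodesicContinuations w r).ncard : ℤ) =
      continuationCount n H r none) ∧
    ∀ w s t k, cs.IsEdgeState w s t k → ((cs.geodesicContinuations w r).ncard : ℤ) =
      continuationCount n H r (some (M s t, k)) := by
  induction r with
  | zero => simp [ncard_geodesicContinuations_zero, continuationCount]
  | succ r ih =>
    obtain ⟨ihV, ihE⟩ := ih
    set a := continuationCount n H r none
    set b : ℕ → ℤ := fun m => continuationCount n H r (some (m, 2))
    have hN : ∀ s, ∑ u, (if M.labelledGraph.graph.Adj s u then b (M s u) - a else 0) =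
        H b - (H fun _ => 1) * a := by
      intro s
      have h1 := hH s b
      have h2 := hH s fun _ => 1
      rw [← h1, ← h2, Finset.sum_mul, ← Finset.sum_sub_distrib]
      exact Finset.sum_congr rfl fun u _ => by split_ifs <;> simp
    have hE : ∀ w u s, cs.IsEdgeState (w * cs.simple u) u s 2 →
        ((cs.geodesicContinuations (w * cs.simple u) r).ncard : ℤ) = b (M s u) := by
      intro w u s h
      rw [ihE _ _ _ _ h, M.symmetric u s]
    refine ⟨fun w s hw => ?_, fun w s t k hw => ?_⟩
    · rw [cs.ncard_geodesicContinuations_succ_eq_sum w r (fun u => a +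
        (if M.labelledGraph.graph.Adj s u then b (M s u) - a else 0) - if u = s then a else 0)]
      · rw [Finset.sum_sub_distrib, Finset.sum_add_distrib, hN, continuationCount]
        simp only [Finset.sum_const, Finset.card_univ, Finset.sum_ite_eq', Finset.mem_univ,
          if_true, nsmul_eq_mul, hn]
        change _ = (n - 1 - H fun _ => 1) * a + H b
        ring
      · intro u
        by_cases hus : u = s
        · subst hus
          simp [(hw.1 u).2 rfl]
        · have hu : ¬ cs.IsRightDescent w u := fun h => hus ((hw.1 u).1 h)
          rw [if_neg hu, if_neg hus, sub_zero]
          by_cases hsu : M.labelledGraph.graph.Adj s u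
          · rw [if_pos hsu, hE w u s (isEdgeState_two_mul_simple hM hT hsu ((hw.1 s).2 rfl) hu
              (hw.2 u hsu))]
            ring
          · rw [if_neg hsu, ihV _ _ (isVertexState_mul_simple hM hu fun v hv huv => ?_), add_zero]
            rw [(hw.1 v).1 hv] at huv
            exact hsu huv.symm
    · have hst := hw.1
      have hs : cs.IsRightDescent w s := (hw.2.2.2.2 s).2 (Or.inl rfl)
      by_cases hk : k < M s t
      · have hd : ∀ v, cs.IsRightDescent w v ↔ v = s := fun v => by
          rw [hw.2.2.2.2 v]
          exact ⟨fun h => h.elim id fun h => by omega, Or.inl⟩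
        -- Every letter is first counted as leading to a vertex state, then corrected: neighbours of
        -- `s` open a new edge, `s` itself is forbidden, and `t` lengthens the current suffix
        -- instead of opening one.
        rw [cs.ncard_geodesicContinuations_succ_eq_sum w r (fun u => a +
          (if M.labelledGraph.graph.Adj s u then b (M s u) - a else 0) - (if u = s then a else 0) +
          if u = t then
            continuationCount n H r (some (M s t, k + 1)) - b (M s t) else 0)]
        · rw [Finset.sum_add_distrib, Finset.sum_sub_distrib, Finset.sum_add_distrib, hN,
            continuationCount, if_pos hk]
          simp only [Finset.sum_const, Finset.card_univ, Finset.sum_ite_eq', Finset.mem_univ,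
            if_true, nsmul_eq_mul, hn]
          change _ = (n - 1 - H fun _ => 1) * a + H b - b (M s t) + _
          ring
        · intro u
          by_cases hus : u = s
          · subst hus
            simp [hs, hst.1]
          · have hu : ¬ cs.IsRightDescent w u := fun h => hus ((hd u).1 h)
            rw [if_neg hu, if_neg hus, sub_zero]
            by_cases hut : u = t
            · subst hut
              rw [if_pos hst, if_pos rfl, ihE _ _ _ _ (isEdgeState_mul_simple hM hT hst hs hu
                hw.2.2.2.1 (by have := hw.2.1; omega) hk), M.symmetric u s]
              ring
            · rw [if_neg hut, add_zero]
              by_cases hsu : M.labelledGraph.graph.Adj s u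
              · rw [if_pos hsu, hE w u s (hw.isEdgeState_two_mul_simple hM hT hsu hut)]
                ring
              · rw [if_neg hsu, ihV _ _ (isVertexState_mul_simple hM hu fun v hv huv => ?_),
                  add_zero]
                rw [(hd v).1 hv] at huv
                exact hsu huv.symm
      · obtain rfl : k = M s t := le_antisymm hw.2.2.1 (not_lt.1 hk)
        have hd : ∀ v, cs.IsRightDescent w v ↔ v = s ∨ v = t := fun v => by
          rw [hw.2.2.2.2 v, and_iff_left rfl]
        have hw' := hw.symm hM
        -- The letters `s` and `t` are each a neighbour of the other, so the neighbour terms give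
        -- them `b (M s t)`, which is subtracted since both are forbidden.
        rw [cs.ncard_geodesicContinuations_succ_eq_sum w r (fun u => a +
          (if M.labelledGraph.graph.Adj s u then b (M s u) - a else 0) +
          (if M.labelledGraph.graph.Adj t u then b (M t u) - a else 0) -
          (if u = s then b (M s t) else 0) - if u = t then b (M s t) else 0)]
        · rw [Finset.sum_sub_distrib, Finset.sum_sub_distrib, Finset.sum_add_distrib,
            Finset.sum_add_distrib, hN, hN, continuationCount, if_neg hk]
          simp only [Finset.sum_const, Finset.card_univ, Finset.sum_ite_eq', Finset.mem_univ,
            if_true, nsmul_eq_mul, hn]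
          change _ = (n - 2 * H fun _ => 1) * a + 2 * (H b - b (M s t))
          ring
        · intro u
          by_cases hus : u = s
          · subst hus
            simp [hs, hst.1, hst.symm, M.symmetric t u]
          by_cases hut : u = t
          · subst hut
            simp [(hd u).2 (Or.inr rfl), hst, hst.1.symm]
          have hu : ¬ cs.IsRightDescent w u := fun h => ((hd u).1 h).elim hus hut
          rw [if_neg hu, if_neg hus, if_neg hut, sub_zero, sub_zero]
          by_cases hsu : M.labelledGraph.graph.Adj s u
          · rw [if_pos hsu, if_neg fun htu => not_adj_of_triangleFree hT hst hsu htu,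
              hE w u s (hw.isEdgeState_two_mul_simple hM hT hsu hut)]
            ring
          · rw [if_neg hsu]
            by_cases htu : M.labelledGraph.graph.Adj t u
            · rw [if_pos htu, hE w u t (hw'.isEdgeState_two_mul_simple hM hT htu hus)]
              ring
            · rw [if_neg htu, ihV _ _ (isVertexState_mul_simple hM hu fun v hv huv => ?_),
                add_zero, add_zero]
              rcases (hd v).1 hv with rfl | rfl
              · exact hsu huv.symm
              · exact htu huv.symm

/-- The geodesic growth of an even Coxeter system with triangle-free and star-regular graph. -/
theorem geodesicGrowth_eq_geodesicCount [Finite B] (hM : M.IsEven)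
    (hT : M.labelledGraph.TriangleFree) (hR : M.labelledGraph.StarRegular) (s : B) (r : ℕ) :
    (cs.geodesicGrowth r : ℤ) =
      geodesicCount (Nat.card B) (M.labelledGraph.star s).edgeSum r := by
  classical
  have := Fintype.ofFinite B
  have hH : ∀ v h, ∑ u, (if M.labelledGraph.graph.Adj v u then h (M v u) else 0) =
      (M.labelledGraph.star s).edgeSum h := by
    intro v h
    obtain ⟨φ⟩ := hR v s
    rw [← φ.edgeSum_eq, LabelledGraph.edgeSum_star _ hT]
    exact Finset.sum_congr rfl fun u _ => by congr
  have h1 : cs.geodesicGrowth r = (cs.geodesicContinuations 1 r).ncard := by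
    simp [geodesicGrowth, geodesicContinuations]
  rw [h1]
  cases r with
  | zero => simp [ncard_geodesicContinuations_zero, geodesicCount]
  | succ r =>
    rw [cs.ncard_geodesicContinuations_succ_eq_sum 1 r (fun _ => continuationCount (Nat.card B)
      (M.labelledGraph.star s).edgeSum r none), geodesicCount]
    · simp
    · intro u
      -- The identity has no descents, so all `n` first letters lead to vertex states.
      rw [if_neg (cs.not_isRightDescent_one u)]
      refine ((cs.ncard_geodesicContinuations_eq hM hT (by simp) _ (fun v h => ?_) r).1 _ u
        (isVertexState_mul_simple hM (cs.not_isRightDescent_one u)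
        fun v hv => absurd hv (cs.not_isRightDescent_one v))).symm
      rw [← hH v h]

end CoxeterSystem

theorem theorem6p15 :
    (∃ F : ℕ → (Σ V : Type u, LabelledGraph V) → (ℕ → ℕ),
      (∀ (n : ℕ) (Γ Δ : Σ V : Type u, LabelledGraph V),
        Nonempty (Γ.2.Iso Δ.2) → F n Γ = F n Δ) ∧
      ∀ (S : Type u) [Finite S] (G : Type v) [Group G] (M : CoxeterMatrix S)
        (cs : CoxeterSystem M G),
        M.IsEven → M.labelledGraph.TriangleFree → M.labelledGraph.StarRegular →
        ∀ s : S, cs.geodesicGrowth = F (Nat.card S) ⟨_, M.labelledGraph.star s⟩) ∧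
    (∀ (S₁ : Type u₁) (S₂ : Type u₂) [Finite S₁] [Finite S₂]
      (G₁ : Type v₁) (G₂ : Type v₂) [Group G₁] [Group G₂]
      (M₁ : CoxeterMatrix S₁) (M₂ : CoxeterMatrix S₂)
      (cs₁ : CoxeterSystem M₁ G₁) (cs₂ : CoxeterSystem M₂ G₂),
      M₁.IsEven → M₁.labelledGraph.TriangleFree → M₁.labelledGraph.StarRegular →
      M₂.IsEven → M₂.labelledGraph.TriangleFree → M₂.labelledGraph.StarRegular →
      Nat.card S₁ = Nat.card S₂ →
      ∀ (s₁ : S₁) (s₂ : S₂),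
        Nonempty ((M₁.labelledGraph.star s₁).Iso (M₂.labelledGraph.star s₂)) →
        cs₁.geodesicGrowth = cs₂.geodesicGrowth) := by
  -- The recursion subtracts, so it lives in `ℤ`. For the systems in question its value is a
  -- cardinality, and `toNat` loses nothing.
  refine ⟨⟨fun n Γ r => (geodesicCount n Γ.2.edgeSum r).toNat, ?_, ?_⟩, ?_⟩
  · rintro n Γ Δ ⟨φ⟩
    simp only [φ.edgeSum_eq]
  · intro S _ G _ M cs hM hT hR s
    funext r
    change _ = (geodesicCount (Nat.card S) (M.labelledGraph.star s).edgeSum r).toNat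
    rw [← cs.geodesicGrowth_eq_geodesicCount hM hT hR s r, Int.toNat_natCast]
  · rintro S₁ S₂ _ _ G₁ G₂ _ _ M₁ M₂ cs₁ cs₂ hM₁ hT₁ hR₁ hM₂ hT₂ hR₂ hcard s₁ s₂ ⟨φ⟩
    funext r
    rw [← Int.natCast_inj, cs₁.geodesicGrowth_eq_geodesicCount hM₁ hT₁ hR₁ s₁,
      cs₂.geodesicGrowth_eq_geodesicCount hM₂ hT₂ hR₂ s₂, hcard, φ.edgeSum_eq]
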